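/- Let $\Gamma$ be a finite simple graph having at least two vertices of degree $|V(\Gamma)|-1$, and suppose that $\Gamma$ is not the triangle $K_3$. Let $P_4$ denote the path with four vertices and three edges; a $P_4$-decomposition of a graph is a set of subgraphs, each isomorphic to $P_4$, whose edge sets partition the edge set of the graph (the empty set is a $P_4$-decomposition of a graph without edges). Then $\Gamma$ admits a $P_4$-decomposition if and only if $|E(\Gamma)|\equiv 0 \pmod 3$. Moreover, for $r\in\{1,2\}$, if $|E(\Gamma)|\equiv r\pmod 3$, then there is a set $R\subseteq E(\Gamma)$ of exactly $r$ edges (which may share a vertex if $r=2$) such that the graph obtained from $\Gamma$ by deleting the edges in $R$ admits a $P_4$-decomposition. -/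

import Mathlib

/-- `B` is an `H`-decomposition of `K` (a `(K, H)`-design): a set of subgraphs of `K`, each
isomorphic to `H`, whose edge sets partition the edge set of `K`. -/
def IsGraphDecomposition {V W : Type*} (K : SimpleGraph V) (H : SimpleGraph W)
    (B : Set K.Subgraph) : Prop :=
  (∀ S ∈ B, Nonempty (S.coe ≃g H)) ∧ ∀ e ∈ K.edgeSet, ∃! S, S ∈ B ∧ e ∈ S.edgeSet

/-- `K` admits a decomposition into paths `P₄` (four vertices and three edges). -/
def HasP4Decomposition {V : Type*} (K : SimpleGraph V) : Prop :=
  ∃ B : Set K.Subgraph, IsGraphDecomposition K (SimpleGraph.pathGraph 4) B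

/-!
Let `a` and `b` be the two vertices adjacent to all others, so that the graph is the join of the
edge `ab` with a graph `H` on the remaining vertices. It is enough to remove edge-disjoint paths
with three edges until at most two edges are left: the number of edges left is then the residue of
the number of edges modulo 3, and the converse holds because every block has three edges.

The removal is an induction on the number of vertices and edges of `H`
(`nearP4Decomposable_join`). A path with three edges inside `H` is removed at once. If `H` has no
such path, its components are triangles and stars. A triangle, together with its edges to `a` and
`b`, splits into three paths (`NearP4Decomposable.add_triangle`). Two leaves of a star with centre
`z` span a `K₂,₃` with `a`, `b`, `z`, which splits into two paths (`NearP4Decomposable.add_twins`).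
What remains is a matching with isolated vertices, which loses three components at a time until few
are left (`nearP4Decomposable_join_matching`). The one join that must not be reached is that with a
single vertex, the triangle; the graphs from which a step would lead to it have explicit
decompositions (such as `nearP4Decomposable_join_cherry`), or another step is taken.

The bookkeeping is done with multisets of edges, where disjoint unions are sums. Only at the end
are the paths turned into subgraphs (`P4Decomposable.exists_subgraphs`).
-/

/-! ### Multisets of edges -/

section Multisets

open Multiset

/-- A multiset of edges that splits into the edge sets of paths with four distinct vertices.
Since multiplicities are kept, unions are sums and no disjointness has to be carried along. -/
inductive P4Decomposable {V : Type*} : Multiset (Sym2 V) → Prop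
  | zero : P4Decomposable 0
  | path {x y z w : V} {M : Multiset (Sym2 V)} (h : [x, y, z, w].Nodup) (hM : P4Decomposable M) :
      P4Decomposable ({s(x, y)} + {s(y, z)} + {s(z, w)} + M)

/-- A multiset of edges that is `P4Decomposable` up to at most two edges. -/
def NearP4Decomposable {V : Type*} (M : Multiset (Sym2 V)) : Prop :=
  ∃ N R : Multiset (Sym2 V), P4Decomposable N ∧ R.card ≤ 2 ∧ M = N + R

namespace NearP4Decomposable

variable {V : Type*} {M R : Multiset (Sym2 V)}

theorem of_card_le_two (h : R.card ≤ 2) : NearP4Decomposable R :=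
  ⟨0, R, .zero, h, by simp⟩

theorem path (hM : NearP4Decomposable M) (x y z w : V) (h : [x, y, z, w].Nodup) :
    NearP4Decomposable ({s(x, y)} + {s(y, z)} + {s(z, w)} + M) := by
  obtain ⟨N, R, hN, hR, rfl⟩ := hM
  exact ⟨_, R, .path h hN, hR, by abel⟩

end NearP4Decomposable

/-- The edges joining each vertex of `W` to both `a` and `b`. -/
def spokes {V : Type*} (a b : V) (W : Multiset V) : Multiset (Sym2 V) :=
  (W.map fun x => {s(a, x)} + {s(b, x)}).sum

/-- The edges of the join of the two vertices `a`, `b` with the matching `L`, without `s(a, b)`. -/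
def joinedMatching {V : Type*} (a b : V) (L : List (V × V)) : Multiset (Sym2 V) :=
  (L.map fun p => {s(p.1, p.2)} + spokes a b {p.1, p.2}).sum

section Spokes

variable {V : Type*} (a b : V)

@[simp] theorem spokes_zero : spokes a b 0 = 0 := rfl

@[simp] theorem spokes_cons (x : V) (W : Multiset V) :
    spokes a b (x ::ₘ W) = {s(a, x)} + {s(b, x)} + spokes a b W := by
  simp [spokes]

@[simp] theorem spokes_singleton (x : V) : spokes a b {x} = {s(a, x)} + {s(b, x)} := by
  simp [spokes]

@[simp] theorem spokes_add (W W' : Multiset V) :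
    spokes a b (W + W') = spokes a b W + spokes a b W' := by
  simp [spokes]

@[simp] theorem joinedMatching_nil : joinedMatching a b [] = 0 := rfl

@[simp] theorem joinedMatching_cons (p : V × V) (L : List (V × V)) :
    joinedMatching a b (p :: L) =
      {s(p.1, p.2)} + spokes a b {p.1, p.2} + joinedMatching a b L := by
  simp [joinedMatching]

end Spokes

/-- The vertices covered by a list of pairs. -/
def pairVertices {V : Type*} (L : List (V × V)) : List V :=
  L.flatMap fun p => [p.1, p.2]

@[simp] theorem pairVertices_nil {V : Type*} : pairVertices ([] : List (V × V)) = [] := rfl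

@[simp] theorem pairVertices_cons {V : Type*} (p : V × V) (L : List (V × V)) :
    pairVertices (p :: L) = p.1 :: p.2 :: pairVertices L := rfl

end Multisets

/-! ### Explicit decompositions -/

section ExplicitDecompositions

open Multiset

set_option linter.unusedSimpArgs false

/-- The join of an edge `ab` with isolated vertices `I` and a matching `L`, other than a triangle.
The recursion removes three components (isolated vertices or matching edges) at a time; what is
left has at most two components, or four isolated vertices, since three of these cannot be removed
without leaving a triangle.

In this and the following decompositions the paths are given by their vertices. Then
`Sym2.eq_swap`, which `simp` applies only when it decreases the term order, orients the edges alike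
on both sides, and `abel` compares the sums. -/
theorem nearP4Decomposable_join_matching {V : Type*} (a b : V) :
    ∀ (I : List V) (L : List (V × V)), (a :: b :: (I ++ pairVertices L)).Nodup →
    ¬ (I.length = 1 ∧ L = []) →
    NearP4Decomposable ({s(a, b)} + spokes a b I + joinedMatching a b L)
  | [], [], _, _ => .of_card_le_two (by simp)
  | [u], [], _, h => by simp at h
  | [], [(x, y)], hnd, _ => by
    simp only [pairVertices_cons, pairVertices_nil, List.cons_append, List.nil_append,
      List.append_nil, List.nodup_cons, List.mem_cons, List.not_mem_nil] at hnd
    have h0 := NearP4Decomposable.of_card_le_two (V := V) (R := 0) (by simp)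
    have h1 := h0.path a b x y (by simp; grind)
    have h2 := h1.path b y a x (by simp; grind)
    convert h2 using 1
    simp only [joinedMatching_cons, joinedMatching_nil, spokes_cons, spokes_singleton, spokes_zero,
      spokes_add, insert_eq_cons, coe_nil, ← cons_coe, Sym2.eq_swap]
    abel
  | [], [(x, y), (z, w)], hnd, _ => by
    simp only [pairVertices_cons, pairVertices_nil, List.cons_append, List.nil_append,
      List.append_nil, List.nodup_cons, List.mem_cons, List.not_mem_nil] at hnd
    have h0 := NearP4Decomposable.of_card_le_two (V := V) (R := {s(a, y)} + {s(x, y)}) (by simp)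
    have h1 := h0.path a b w z (by simp; grind)
    have h2 := h1.path a x b y (by simp; grind)
    have h3 := h2.path b z a w (by simp; grind)
    convert h3 using 1
    simp only [joinedMatching_cons, joinedMatching_nil, spokes_cons, spokes_singleton, spokes_zero,
      spokes_add, insert_eq_cons, coe_nil, ← cons_coe, Sym2.eq_swap]
    abel
  | [u], [(x, y)], hnd, _ => by
    simp only [pairVertices_cons, pairVertices_nil, List.cons_append, List.nil_append,
      List.append_nil, List.nodup_cons, List.mem_cons, List.not_mem_nil] at hnd
    have h0 := NearP4Decomposable.of_card_le_two (V := V) (R := {s(a, y)} + {s(a, x)}) (by simp)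
    have h1 := h0.path a b x y (by simp; grind)
    have h2 := h1.path a u b y (by simp; grind)
    convert h2 using 1
    simp only [joinedMatching_cons, joinedMatching_nil, spokes_cons, spokes_singleton, spokes_zero,
      spokes_add, insert_eq_cons, coe_nil, ← cons_coe, Sym2.eq_swap]
    abel
  | [u, v], [], hnd, _ => by
    simp only [pairVertices_cons, pairVertices_nil, List.cons_append, List.nil_append,
      List.append_nil, List.nodup_cons, List.mem_cons, List.not_mem_nil] at hnd
    have h0 := NearP4Decomposable.of_card_le_two (V := V) (R := {s(a, v)} + {s(a, b)}) (by simp)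
    have h1 := h0.path a u b v (by simp; grind)
    convert h1 using 1
    simp only [joinedMatching_cons, joinedMatching_nil, spokes_cons, spokes_singleton, spokes_zero,
      spokes_add, insert_eq_cons, coe_nil, ← cons_coe, Sym2.eq_swap]
    abel
  | [u, v, w, t], [], hnd, _ => by
    simp only [pairVertices_cons, pairVertices_nil, List.cons_append, List.nil_append,
      List.append_nil, List.nodup_cons, List.mem_cons, List.not_mem_nil] at hnd
    have h0 := NearP4Decomposable.of_card_le_two (V := V) (R := 0) (by simp)
    have h1 := h0.path t a b u (by simp; grind)
    have h2 := h1.path b v a u (by simp; grind)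
    have h3 := h2.path a w b t (by simp; grind)
    convert h3 using 1
    simp only [joinedMatching_cons, joinedMatching_nil, spokes_cons, spokes_singleton, spokes_zero,
      spokes_add, insert_eq_cons, coe_nil, ← cons_coe, Sym2.eq_swap]
    abel
  | [], (x, y) :: (z, w) :: (s, t) :: L, hnd, _ => by
    simp only [pairVertices_cons, pairVertices_nil, List.cons_append, List.nil_append,
      List.append_nil, List.nodup_cons, List.mem_cons, List.not_mem_nil] at hnd
    have h0 := nearP4Decomposable_join_matching a b [] L (by simp; grind) (by simp)
    have h1 := h0.path a s b t (by simp; grind)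
    have h2 := h1.path s t a w (by simp; grind)
    have h3 := h2.path a x b w (by simp; grind)
    have h4 := h3.path w z a y (by simp; grind)
    have h5 := h4.path x y b z (by simp; grind)
    convert h5 using 1
    simp only [joinedMatching_cons, joinedMatching_nil, spokes_cons, spokes_singleton, spokes_zero,
      spokes_add, insert_eq_cons, coe_nil, ← cons_coe, Sym2.eq_swap]
    abel
  | [u], (x, y) :: (z, w) :: L, hnd, _ => by
    simp only [pairVertices_cons, pairVertices_nil, List.cons_append, List.nil_append,
      List.append_nil, List.nodup_cons, List.mem_cons, List.not_mem_nil] at hnd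
    have h0 := nearP4Decomposable_join_matching a b [] L (by simp; grind) (by simp)
    have h1 := h0.path a u b w (by simp; grind)
    have h2 := h1.path a w z b (by simp; grind)
    have h3 := h2.path a x b y (by simp; grind)
    have h4 := h3.path x y a z (by simp; grind)
    convert h4 using 1
    simp only [joinedMatching_cons, joinedMatching_nil, spokes_cons, spokes_singleton, spokes_zero,
      spokes_add, insert_eq_cons, coe_nil, ← cons_coe, Sym2.eq_swap]
    abel
  | [u, v], (x, y) :: L, hnd, _ => by
    simp only [pairVertices_cons, pairVertices_nil, List.cons_append, List.nil_append,
      List.append_nil, List.nodup_cons, List.mem_cons, List.not_mem_nil] at hnd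
    have h0 := nearP4Decomposable_join_matching a b [] L (by simp; grind) (by simp)
    have h1 := h0.path a u b v (by simp; grind)
    have h2 := h1.path v a x y (by simp; grind)
    have h3 := h2.path a y b x (by simp; grind)
    convert h3 using 1
    simp only [joinedMatching_cons, joinedMatching_nil, spokes_cons, spokes_singleton, spokes_zero,
      spokes_add, insert_eq_cons, coe_nil, ← cons_coe, Sym2.eq_swap]
    abel
  | u :: v :: w :: [], L, hnd, _ => by
    simp only [pairVertices_cons, pairVertices_nil, List.cons_append, List.nil_append,
      List.append_nil, List.nodup_cons, List.mem_cons, List.not_mem_nil] at hnd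
    have h0 := nearP4Decomposable_join_matching a b [] L (by simp; grind) (by simp)
    have h1 := h0.path a u b v (by simp; grind)
    have h2 := h1.path b w a v (by simp; grind)
    convert h2 using 1
    simp only [joinedMatching_cons, joinedMatching_nil, spokes_cons, spokes_singleton, spokes_zero,
      spokes_add, insert_eq_cons, coe_nil, ← cons_coe, Sym2.eq_swap]
    abel
  | u :: v :: w :: t :: [], p :: L, hnd, _ => by
    simp only [pairVertices_cons, pairVertices_nil, List.cons_append, List.nil_append,
      List.append_nil, List.nodup_cons, List.mem_cons, List.not_mem_nil] at hnd
    have h0 := nearP4Decomposable_join_matching a b [t] (p :: L) (by simp; grind) (by simp)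
    have h1 := h0.path a u b v (by simp; grind)
    have h2 := h1.path b w a v (by simp; grind)
    convert h2 using 1
    simp only [joinedMatching_cons, joinedMatching_nil, spokes_cons, spokes_singleton, spokes_zero,
      spokes_add, insert_eq_cons, coe_nil, ← cons_coe, Sym2.eq_swap]
    abel
  | u :: v :: w :: t :: r :: I, L, hnd, _ => by
    simp only [pairVertices_cons, pairVertices_nil, List.cons_append, List.nil_append,
      List.append_nil, List.nodup_cons, List.mem_cons, List.not_mem_nil] at hnd
    have h0 := nearP4Decomposable_join_matching a b (t :: r :: I) L (by simp; grind) (by simp)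
    have h1 := h0.path a u b v (by simp; grind)
    have h2 := h1.path b w a v (by simp; grind)
    convert h2 using 1
    simp only [joinedMatching_cons, joinedMatching_nil, spokes_cons, spokes_singleton, spokes_zero,
      spokes_add, insert_eq_cons, coe_nil, ← cons_coe, Sym2.eq_swap]
    abel
  termination_by I L => I.length + L.length

variable {V : Type*} {a b x y z u : V} {M : Multiset (Sym2 V)}

/-- Two vertices `x`, `y` with the three neighbours `a`, `b`, `z` span a `K₂,₃`, which splits into
two paths. -/
theorem NearP4Decomposable.add_twins (hM : NearP4Decomposable M) (h : [a, b, x, y, z].Nodup) :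
    NearP4Decomposable (spokes a b {x, y} + {s(z, x)} + {s(z, y)} + M) := by
  simp only [List.nodup_cons, List.mem_cons, List.not_mem_nil] at h
  have h1 := hM.path a x b y (by simp; grind)
  have h2 := h1.path x z y a (by simp; grind)
  convert h2 using 1
  simp only [joinedMatching_cons, joinedMatching_nil, spokes_cons, spokes_singleton, spokes_zero,
    spokes_add, insert_eq_cons, coe_nil, ← cons_coe, Sym2.eq_swap]
  abel

theorem NearP4Decomposable.add_triangle (hM : NearP4Decomposable M) (h : [a, b, x, y, z].Nodup) :
    NearP4Decomposable (spokes a b {x, y, z} + {s(x, y)} + {s(x, z)} + {s(y, z)} + M) := by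
  simp only [List.nodup_cons, List.mem_cons, List.not_mem_nil] at h
  have h1 := hM.path a x b y (by simp; grind)
  have h2 := h1.path a y z b (by simp; grind)
  have h3 := h2.path a z x y (by simp; grind)
  convert h3 using 1
  simp only [joinedMatching_cons, joinedMatching_nil, spokes_cons, spokes_singleton, spokes_zero,
    spokes_add, insert_eq_cons, coe_nil, ← cons_coe, Sym2.eq_swap]
  abel

/-- The join of `ab` with a cherry; removing its leaves as twins would leave a triangle. -/
theorem nearP4Decomposable_join_cherry (h : [a, b, x, y, z].Nodup) :
    NearP4Decomposable ({s(a, b)} + spokes a b {x, y, z} + {s(z, x)} + {s(z, y)}) := by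
  simp only [List.nodup_cons, List.mem_cons, List.not_mem_nil] at h
  have h0 := NearP4Decomposable.of_card_le_two (V := V) (R := 0) (by simp)
  have h1 := h0.path a b x z (by simp; grind)
  have h2 := h1.path x a y z (by simp; grind)
  have h3 := h2.path a z b y (by simp; grind)
  convert h3 using 1
  simp only [joinedMatching_cons, joinedMatching_nil, spokes_cons, spokes_singleton, spokes_zero,
    spokes_add, insert_eq_cons, coe_nil, ← cons_coe, Sym2.eq_swap]
  abel

/-- The join of `ab` with a triangle and an isolated vertex; removing the triangle would leave a
triangle. -/
theorem nearP4Decomposable_join_triangle (h : [a, b, x, y, z, u].Nodup) :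
    NearP4Decomposable
      ({s(a, b)} + spokes a b {x, y, z, u} + {s(x, y)} + {s(x, z)} + {s(y, z)}) := by
  simp only [List.nodup_cons, List.mem_cons, List.not_mem_nil] at h
  have h0 := NearP4Decomposable.of_card_le_two (V := V) (R := 0) (by simp)
  have h1 := h0.path a b x y (by simp; grind)
  have h2 := h1.path a u b y (by simp; grind)
  have h3 := h2.path a x z y (by simp; grind)
  have h4 := h3.path b z a y (by simp; grind)
  convert h4 using 1
  simp only [joinedMatching_cons, joinedMatching_nil, spokes_cons, spokes_singleton, spokes_zero,
    spokes_add, insert_eq_cons, coe_nil, ← cons_coe, Sym2.eq_swap]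
  abel

end ExplicitDecompositions

/-! ### The induction on joins with an edge -/

section Induction

open Multiset

variable {V : Type*} [DecidableEq V] {a b : V}

/-- The join of the edge `ab` with the disjoint union of the graph `(S, H)` and a matching `L`,
other than a triangle. The matching only serves to collect the isolated edges met in the
induction. -/
theorem nearP4Decomposable_join (S : Finset V) (H : Finset (Sym2 V)) (L : List (V × V))
    (hdiag : ∀ e ∈ H, ¬ e.IsDiag) (hS : ∀ e ∈ H, ∀ v ∈ e, v ∈ S)
    (hL : (a :: b :: pairVertices L).Nodup) (hSL : ∀ v ∈ S, v ∉ a :: b :: pairVertices L)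
    (h1 : ¬ (S.card = 1 ∧ L = [])) :
    NearP4Decomposable ({s(a, b)} + spokes a b S.val + H.val + joinedMatching a b L) := by
  have hne : ∀ {u v : V}, s(u, v) ∈ H → u ≠ v := fun h => by simpa using hdiag _ h
  have hmem : ∀ {u v : V}, s(u, v) ∈ H → u ∈ S ∧ v ∈ S := fun h =>
    ⟨hS _ h _ (by simp), hS _ h _ (by simp)⟩
  have hsymm : ∀ {u v : V}, s(u, v) ∈ H → s(v, u) ∈ H := fun h => Sym2.eq_swap ▸ h
  have split : ∀ {α : Type _} [DecidableEq α] {A B : Finset α}, A ⊆ B →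
      B.val = A.val + (B \ A).val := fun h => by
    rw [Finset.sdiff_val, add_tsub_cancel_of_le (Finset.val_le_iff.2 h)]
  by_cases hP : ∃ x y z w : V, [x, y, z, w].Nodup ∧ s(x, y) ∈ H ∧ s(y, z) ∈ H ∧ s(z, w) ∈ H
  · obtain ⟨x, y, z, w, hnd, hxy, hyz, hzw⟩ := hP
    have hsub : ({s(x, y), s(y, z), s(z, w)} : Finset (Sym2 V)) ⊆ H := by
      simp [Finset.insert_subset_iff, hxy, hyz, hzw]
    have hlt : (H \ {s(x, y), s(y, z), s(z, w)}).card < H.card :=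
      Finset.card_lt_card (Finset.sdiff_ssubset hsub (by simp))
    have ih := (nearP4Decomposable_join S (H \ {s(x, y), s(y, z), s(z, w)}) L
      (fun e he => hdiag e (Finset.sdiff_subset he)) (fun e he => hS e (Finset.sdiff_subset he))
      hL hSL h1).path x y z w hnd
    have hval : ({s(x, y), s(y, z), s(z, w)} : Finset (Sym2 V)).val =
        {s(x, y)} + {s(y, z)} + {s(z, w)} := by
      rw [Finset.insert_val_of_notMem (by simp; grind),
        Finset.insert_val_of_notMem (by simp; grind)]
      rfl
    rw [split hsub, hval]
    convert ih using 1
    abel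
  have hfree : ∀ x y z w : V, [x, y, z, w].Nodup → s(x, y) ∈ H → s(y, z) ∈ H → s(z, w) ∉ H :=
    fun x y z w hnd hxy hyz hzw => hP ⟨x, y, z, w, hnd, hxy, hyz, hzw⟩
  -- If `F` contains the edges of `H` that meet `T`, deleting `T` and `F` leaves a graph on `S \ T`.
  have hsub : ∀ {T : Finset V} {F : Finset (Sym2 V)}, (∀ e ∈ H, e ∉ F → ∀ v ∈ e, v ∉ T) →
      ∀ e ∈ H \ F, ∀ v ∈ e, v ∈ S \ T := fun hF e he v hv => by
    rw [Finset.mem_sdiff] at he ⊢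
    exact ⟨hS e he.1 v hv, hF e he.1 he.2 v hv⟩
  have hrest : ∀ {T : Finset V} {F : Finset (Sym2 V)}, (∀ e ∈ H, e ∉ F → ∀ v ∈ e, v ∉ T) →
      ∀ u, S \ T = {u} → H \ F = ∅ := fun {T F} hF u hu => by
    refine Finset.eq_empty_of_forall_notMem fun e he => ?_
    have heu := hsub hF e he
    rw [hu] at heu
    induction e with | h v w
    exact hne (Finset.sdiff_subset he) ((Finset.mem_singleton.1 (heu v (by simp))).trans
      (Finset.mem_singleton.1 (heu w (by simp))).symm)
  by_cases hC : ∃ x y z : V, x ≠ y ∧ s(z, x) ∈ H ∧ s(z, y) ∈ H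
  · obtain ⟨x, y, z, hxy, hzx, hzy⟩ := hC
    have hzx' := hne hzx
    have hzy' := hne hzy
    have hxS := (hmem hzx).2
    have hyS := (hmem hzy).2
    have hzS := (hmem hzx).1
    have habxyz : [a, b, x, y, z].Nodup := by
      have := hSL x hxS
      have := hSL y hyS
      have := hSL z hzS
      simp at hL this ⊢
      grind
    by_cases hT : s(x, y) ∈ H
    · -- A fourth vertex adjacent to the triangle would start a path with three edges.
      have hF : ∀ e ∈ H, e ∉ ({s(x, y), s(x, z), s(y, z)} : Finset (Sym2 V)) →
          ∀ v ∈ e, v ∉ ({x, y, z} : Finset V) := by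
        rintro e he heF v ⟨u, rfl⟩ hv
        have hvu := hne he
        simp only [Finset.mem_insert, Finset.mem_singleton, Sym2.eq_iff, not_or, not_and] at heF hv
        rcases hv with rfl | rfl | rfl
        · exact hfree u v y z (by simp; grind) (hsymm he) hT (hsymm hzy)
        · exact hfree u v x z (by simp; grind) (hsymm he) (hsymm hT) (hsymm hzx)
        · exact hfree u v x y (by simp; grind) (hsymm he) hzx hT
      have hTS : ({x, y, z} : Finset V) ⊆ S := by simp [Finset.insert_subset_iff, *]
      have hFH : ({s(x, y), s(x, z), s(y, z)} : Finset (Sym2 V)) ⊆ H := by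
        simp [Finset.insert_subset_iff, hT, hsymm hzx, hsymm hzy]
      have hlt : (S \ {x, y, z}).card < S.card :=
        Finset.card_lt_card (Finset.sdiff_ssubset hTS (by simp))
      have hle : (H \ {s(x, y), s(x, z), s(y, z)}).card ≤ H.card :=
        Finset.card_le_card Finset.sdiff_subset
      have hTval : ({x, y, z} : Finset V).val = {x, y, z} := by
        rw [Finset.insert_val_of_notMem (by simp; grind),
          Finset.insert_val_of_notMem (by simp; grind)]
        rfl
      have hFval : ({s(x, y), s(x, z), s(y, z)} : Finset (Sym2 V)).val =
          {s(x, y)} + {s(x, z)} + {s(y, z)} := by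
        rw [Finset.insert_val_of_notMem (by simp; grind),
          Finset.insert_val_of_notMem (by simp; grind)]
        rfl
      rw [split hTS, split hFH, hTval, hFval, spokes_add]
      by_cases h1' : (S \ {x, y, z}).card = 1 ∧ L = []
      · obtain ⟨u, hu⟩ := Finset.card_eq_one.1 h1'.1
        have huS : u ∈ S \ {x, y, z} := by simp [hu]
        have habu := hSL u (Finset.sdiff_subset huS)
        have hnd : [a, b, x, y, z, u].Nodup := by
          simp at habxyz huS habu ⊢
          grind
        rw [hrest hF u hu, hu, h1'.2]
        convert nearP4Decomposable_join_triangle hnd using 1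
        simp only [spokes_cons, insert_eq_cons, Finset.singleton_val, spokes_singleton,
          joinedMatching_nil, Finset.empty_val]
        abel
      · convert (nearP4Decomposable_join (S \ {x, y, z}) (H \ {s(x, y), s(x, z), s(y, z)}) L
          (fun e he => hdiag e (Finset.sdiff_subset he)) (hsub hF) hL
          (fun v hv => hSL v (Finset.sdiff_subset hv)) h1').add_triangle habxyz using 1
        abel
    · -- A second neighbour of `x` or `y` would start a path with three edges.
      have hF : ∀ e ∈ H, e ∉ ({s(z, x), s(z, y)} : Finset (Sym2 V)) →
          ∀ v ∈ e, v ∉ ({x, y} : Finset V) := by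
        rintro e he heF v ⟨u, rfl⟩ hv
        have hvu := hne he
        simp only [Finset.mem_insert, Finset.mem_singleton, Sym2.eq_iff, not_or, not_and] at heF hv
        rcases hv with rfl | rfl
        · have huy : u ≠ y := by
            rintro rfl
            exact hT he
          exact hfree u v z y (by simp; grind) (hsymm he) (hsymm hzx) hzy
        · have hux : u ≠ x := by
            rintro rfl
            exact hT (hsymm he)
          exact hfree u v z x (by simp; grind) (hsymm he) (hsymm hzy) hzx
      have hTS : ({x, y} : Finset V) ⊆ S := by simp [Finset.insert_subset_iff, *]
      have hFH : ({s(z, x), s(z, y)} : Finset (Sym2 V)) ⊆ H := by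
        simp [Finset.insert_subset_iff, hzx, hzy]
      have hlt : (S \ {x, y}).card < S.card :=
        Finset.card_lt_card (Finset.sdiff_ssubset hTS (by simp))
      have hle : (H \ {s(z, x), s(z, y)}).card ≤ H.card := Finset.card_le_card Finset.sdiff_subset
      have hTval : ({x, y} : Finset V).val = {x, y} := by
        rw [Finset.insert_val_of_notMem (by simpa using hxy)]
        rfl
      have hFval : ({s(z, x), s(z, y)} : Finset (Sym2 V)).val = {s(z, x)} + {s(z, y)} := by
        rw [Finset.insert_val_of_notMem (by simp; grind)]
        rfl
      rw [split hTS, split hFH, hTval, hFval, spokes_add]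
      by_cases h1' : (S \ {x, y}).card = 1 ∧ L = []
      · obtain ⟨u, hu⟩ := Finset.card_eq_one.1 h1'.1
        have hzu : z = u := by
          have : z ∈ S \ {x, y} := by simp [hzS, hzx', hzy']
          simpa [hu] using this
        subst hzu
        rw [hrest hF z hu, hu, h1'.2]
        convert nearP4Decomposable_join_cherry habxyz using 1
        simp only [spokes_cons, insert_eq_cons, Finset.singleton_val, spokes_singleton,
          joinedMatching_nil, Finset.empty_val]
        abel
      · convert (nearP4Decomposable_join (S \ {x, y}) (H \ {s(z, x), s(z, y)}) L
          (fun e he => hdiag e (Finset.sdiff_subset he)) (hsub hF) hL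
          (fun v hv => hSL v (Finset.sdiff_subset hv)) h1').add_twins habxyz using 1
        abel
  -- Now every vertex has at most one neighbour in `H`: an edge of `H` is a component.
  by_cases hH : H = ∅
  · subst hH
    have := nearP4Decomposable_join_matching a b S.toList L (by
      have := S.nodup_toList
      simp only [List.nodup_cons, List.mem_cons, List.nodup_append, List.mem_append,
        Finset.mem_toList] at hL hSL ⊢
      grind) (by simpa using h1)
    simpa using this
  · obtain ⟨e, he⟩ := Finset.nonempty_iff_ne_empty.2 hH
    induction e with | h x y
    have hxy := hne he
    have hxS := (hmem he).1
    have hyS := (hmem he).2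
    have hlt : (H.erase s(x, y)).card < H.card := Finset.card_erase_lt_of_mem he
    have hle : (S \ {x, y}).card ≤ S.card := Finset.card_le_card Finset.sdiff_subset
    have ih := nearP4Decomposable_join (S \ {x, y}) (H.erase s(x, y)) ((x, y) :: L)
      (fun e he => hdiag e (Finset.mem_of_mem_erase he)) (by
        intro e he' v hv
        obtain ⟨u, rfl⟩ := hv
        rw [Finset.mem_erase] at he'
        have hvS := (hmem he'.2).1
        have hvx : v ≠ x := by
          rintro rfl
          exact hC ⟨u, y, v, by rintro rfl; exact he'.1 rfl, he'.2, he⟩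
        have hvy : v ≠ y := by
          rintro rfl
          exact hC ⟨u, x, v, by rintro rfl; exact he'.1 Sym2.eq_swap, he'.2, hsymm he⟩
        simp [hvS, hvx, hvy]) (by
        simp at hL hSL ⊢
        grind) (by
        simp at hSL ⊢
        grind) (by simp)
    rw [split (A := {x, y}) (B := S) (by simp [Finset.insert_subset_iff, hxS, hyS]),
      Finset.insert_val_of_notMem (by simpa using hxy)]
    rw [← Finset.insert_erase he, Finset.insert_val_of_notMem (by simp)]
    convert ih using 1
    simp only [spokes_add, Finset.singleton_val, spokes_singleton, joinedMatching_cons,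
      insert_eq_cons, ← singleton_add]
    abel
termination_by S.card + H.card

end Induction

/-! ### From multisets of edges to subgraphs -/

section Graphs

open SimpleGraph Multiset

theorem P4Decomposable.three_dvd_card {V : Type*} {M : Multiset (Sym2 V)}
    (h : P4Decomposable M) : 3 ∣ M.card := by
  induction h with
  | zero => simp
  | path _ _ ih => simpa using (Nat.dvd_add_right (dvd_refl 3)).2 ih

theorem pathGraph_four_edgeSet :
    (pathGraph 4).edgeSet = {s(0, 1), s(1, 2), s(2, 3)} := by
  ext e
  induction e with | h i j
  simp only [mem_edgeSet, pathGraph_adj, Set.mem_insert_iff, Set.mem_singleton_iff]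
  revert i j
  decide

theorem pathGraph_four_ncard_edgeSet : (pathGraph 4).edgeSet.ncard = 3 := by
  rw [pathGraph_four_edgeSet, Set.ncard_eq_toFinset_card']
  decide

theorem exists_subgraph_iso_pathGraph_four {V : Type*} (K : SimpleGraph V) {x y z w : V}
    (hnd : [x, y, z, w].Nodup) (hxy : K.Adj x y) (hyz : K.Adj y z) (hzw : K.Adj z w) :
    ∃ S : K.Subgraph, Nonempty (S.coe ≃g pathGraph 4) ∧
      S.edgeSet = {s(x, y), s(y, z), s(z, w)} := by
  have hadj : ∀ {i j : Fin 4}, (pathGraph 4).Adj i j →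
      K.Adj (![x, y, z, w] i) (![x, y, z, w] j) := by
    intro i j h
    rw [pathGraph_adj] at h
    fin_cases i <;> fin_cases j <;> simp at h ⊢ <;> first | assumption | (symm; assumption)
  have hinj : Function.Injective ![x, y, z, w] := by
    simp only [List.nodup_cons, List.mem_cons, List.not_mem_nil] at hnd
    intro i j h
    fin_cases i <;> fin_cases j <;> simp at h ⊢ <;> grind
  let f : Copy (pathGraph 4) K := ⟨⟨![x, y, z, w], hadj⟩, hinj⟩
  refine ⟨f.toSubgraph, ⟨f.isoToSubgraph.symm⟩, ?_⟩
  rw [Copy.toSubgraph, Subgraph.edgeSet_map, Subgraph.edgeSet_top, pathGraph_four_edgeSet]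
  simp [Set.image_insert_eq, f]

/-- A duplicate-free `P4Decomposable` multiset of edges of `K` is partitioned by a set of subgraphs
of `K` isomorphic to `P₄`. -/
theorem P4Decomposable.exists_subgraphs {V : Type*} (K : SimpleGraph V) {M : Multiset (Sym2 V)}
    (hM : P4Decomposable M) (hnd : M.Nodup) (hK : ∀ e ∈ M, e ∈ K.edgeSet) :
    ∃ B : Set K.Subgraph, (∀ S ∈ B, Nonempty (S.coe ≃g pathGraph 4)) ∧
      (∀ S ∈ B, ∀ e ∈ S.edgeSet, e ∈ M) ∧ ∀ e ∈ M, ∃! S, S ∈ B ∧ e ∈ S.edgeSet := by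
  induction hM with
  | zero => exact ⟨∅, by simp, by simp, by simp⟩
  | @path x y z w M h hM ih =>
    obtain ⟨-, hnd', hdisj⟩ := nodup_add.1 hnd
    obtain ⟨B, hiso, hsub, huniq⟩ := ih hnd' fun e he => hK e (by simp [he])
    obtain ⟨T, hT, hTe⟩ := exists_subgraph_iso_pathGraph_four K h
      (hK s(x, y) (by simp)) (hK s(y, z) (by simp)) (hK s(z, w) (by simp))
    have hmem : ∀ e, e ∈ ({s(x, y)} + {s(y, z)} + {s(z, w)} : Multiset (Sym2 V)) ↔
        e ∈ T.edgeSet := by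
      intro e
      simp [hTe]
    refine ⟨insert T B, ?_, ?_, ?_⟩
    · rintro S (rfl | hS)
      exacts [hT, hiso S hS]
    · rintro S (rfl | hS) e he
      · exact mem_add.2 (.inl ((hmem e).2 he))
      · exact mem_add.2 (.inr (hsub S hS e he))
    · intro e he
      rcases mem_add.1 he with he | he
      · refine ⟨T, ⟨Set.mem_insert _ _, (hmem e).1 he⟩, ?_⟩
        rintro S ⟨rfl | hS, heS⟩
        · rfl
        · exact (Multiset.disjoint_left.1 hdisj he (hsub S hS e heS)).elim
      · obtain ⟨S, ⟨hS, heS⟩, hu⟩ := huniq e he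
        refine ⟨S, ⟨Set.mem_insert_of_mem _ hS, heS⟩, ?_⟩
        rintro S' ⟨rfl | hS', heS'⟩
        · exact (Multiset.disjoint_left.1 hdisj ((hmem e).2 heS') he).elim
        · exact hu S' ⟨hS', heS'⟩

theorem P4Decomposable.hasP4Decomposition {V : Type*} (K : SimpleGraph V) {M : Multiset (Sym2 V)}
    (hM : P4Decomposable M) (hnd : M.Nodup) (hK : ∀ e, e ∈ M ↔ e ∈ K.edgeSet) :
    HasP4Decomposition K := by
  obtain ⟨B, hiso, -, huniq⟩ := hM.exists_subgraphs K hnd fun e => (hK e).1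
  exact ⟨B, hiso, fun e he => huniq e ((hK e).2 he)⟩

theorem HasP4Decomposition.three_dvd_card_edgeFinset {V : Type*} [Fintype V] [DecidableEq V]
    {K : SimpleGraph V} [DecidableRel K.Adj] (h : HasP4Decomposition K) :
    3 ∣ K.edgeFinset.card := by
  classical
  obtain ⟨B, hiso, huniq⟩ := h
  have hunion : K.edgeFinset = B.toFinite.toFinset.biUnion fun S => S.edgeSet.toFinset := by
    ext e
    simp only [mem_edgeFinset, Finset.mem_biUnion, Set.Finite.mem_toFinset, Set.mem_toFinset]
    exact ⟨fun he => (huniq e he).exists, fun ⟨S, _, he⟩ => S.edgeSet_subset he⟩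
  rw [hunion, Finset.card_biUnion]
  · refine Finset.dvd_sum fun S hS => ?_
    obtain ⟨φ⟩ := hiso S (by simpa using hS)
    rw [← Set.ncard_eq_toFinset_card', ← Subgraph.image_coe_edgeSet_coe,
      Set.ncard_image_of_injective _ (Sym2.map.injective Subtype.val_injective),
      Set.ncard_congr' φ.mapEdgeSet, pathGraph_four_ncard_edgeSet]
  · intro S hS T hT hST
    rw [Function.onFun, Finset.disjoint_left]
    intro e heS heT
    simp only [Finset.mem_coe, Set.Finite.mem_toFinset] at hS hT
    rw [Set.mem_toFinset] at heS heT
    exact hST ((huniq e (S.edgeSet_subset heS)).unique ⟨hS, heS⟩ ⟨hT, heT⟩)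

theorem SimpleGraph.adj_of_degree_eq_card_sub_one {V : Type*} [Fintype V] [DecidableEq V]
    {Γ : SimpleGraph V} [DecidableRel Γ.Adj] {a v : V} (h : Γ.degree a = Fintype.card V - 1)
    (hv : v ≠ a) : Γ.Adj a v := by
  have hsub : Γ.neighborFinset a ⊆ Finset.univ.erase a := by
    intro u hu
    simpa using ((Γ.mem_neighborFinset a u).1 hu).ne'
  have := Finset.eq_of_subset_of_card_le hsub (by
    simp [Finset.card_erase_of_mem, h])
  rw [← mem_neighborFinset, this]
  simpa using hv

theorem spokes_eq_map_add_map {V : Type*} (a b : V) (W : Multiset V) :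
    spokes a b W = W.map (fun v => s(a, v)) + W.map fun v => s(b, v) := by
  induction W using Multiset.induction with
  | empty => rfl
  | cons x W ih =>
    rw [spokes_cons, ih, map_cons, map_cons, ← singleton_add, ← singleton_add]
    abel

/-- A graph with two vertices adjacent to all others, as the join of these two vertices with the
graph induced on the remaining ones. -/
theorem edgeFinset_val_eq_join {V : Type*} [Fintype V] [DecidableEq V] (Γ : SimpleGraph V)
    [DecidableRel Γ.Adj] {a b : V} (hab : a ≠ b) (ha : ∀ v, v ≠ a → Γ.Adj a v)
    (hb : ∀ v, v ≠ b → Γ.Adj b v) :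
    Γ.edgeFinset.val = {s(a, b)} + spokes a b ({a, b} : Finset V)ᶜ.val +
      (Γ.edgeFinset.filter fun e => a ∉ e ∧ b ∉ e).val := by
  rw [spokes_eq_map_add_map]
  refine (Nodup.ext (Finset.nodup _) ?_).2 ?_
  · have hinj : ∀ c : V, Function.Injective fun v => s(c, v) := fun c u v h =>
      Sym2.congr_right.1 h
    rw [nodup_add, nodup_add, nodup_add]
    refine ⟨⟨nodup_singleton _, ⟨(Finset.nodup _).map (hinj a), (Finset.nodup _).map (hinj b), ?_⟩,
      ?_⟩, Finset.nodup _, ?_⟩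
    · simp only [Multiset.disjoint_left, mem_map, Finset.mem_val, Finset.mem_compl,
        Finset.mem_insert, Finset.mem_singleton]
      rintro _ ⟨u, hu, rfl⟩ ⟨v, hv, huv⟩
      simp only [Sym2.eq_iff] at huv
      grind
    · simp only [Multiset.disjoint_left, mem_singleton, mem_add, mem_map, Finset.mem_val,
        Finset.mem_compl, Finset.mem_insert, Finset.mem_singleton]
      rintro _ rfl (⟨u, hu, huv⟩ | ⟨u, hu, huv⟩) <;>
      · simp only [Sym2.eq_iff] at huv
        grind
    · simp only [Multiset.disjoint_left, mem_singleton, mem_add, mem_map, Finset.mem_val,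
        Finset.mem_filter]
      rintro _ (rfl | ⟨u, hu, rfl⟩ | ⟨u, hu, rfl⟩) <;> simp
  · intro e
    induction e with | h u v
    have hstar : ∀ c : V, (∃ x, ¬ (x = a ∨ x = b) ∧ (c = u ∧ x = v ∨ c = v ∧ x = u)) ↔
        c = u ∧ ¬ (v = a ∨ v = b) ∨ c = v ∧ ¬ (u = a ∨ u = b) := fun c => by
      constructor
      · rintro ⟨x, hx, ⟨rfl, rfl⟩ | ⟨rfl, rfl⟩⟩
        exacts [.inl ⟨rfl, hx⟩, .inr ⟨rfl, hx⟩]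
      · rintro (⟨rfl, hx⟩ | ⟨rfl, hx⟩)
        exacts [⟨v, hx, .inl ⟨rfl, rfl⟩⟩, ⟨u, hx, .inr ⟨rfl, rfl⟩⟩]
    simp only [Finset.mem_val, mem_edgeFinset, mem_edgeSet, mem_add, mem_singleton, mem_map,
      Finset.mem_compl, Finset.mem_insert, Finset.mem_singleton, Finset.mem_filter, Sym2.mem_iff,
      Sym2.eq_iff, hstar]
    have hau := fun h => (ha u h).symm
    have hbu := fun h => (hb u h).symm
    refine ⟨fun h => ?_, ?_⟩
    · have := h.ne
      grind
    · grind

/-- All three residue classes at once: some at most two edges, as many as the residue requires, can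
be deleted to leave a graph with a `P₄`-decomposition. -/
theorem exists_edges_hasP4Decomposition {V : Type*} [Fintype V] [DecidableEq V] (Γ : SimpleGraph V)
    [DecidableRel Γ.Adj]
    (hdeg : ∃ a b : V, a ≠ b ∧ Γ.degree a = Fintype.card V - 1 ∧
      Γ.degree b = Fintype.card V - 1)
    (hK3 : ¬ Nonempty (Γ ≃g (⊤ : SimpleGraph (Fin 3)))) :
    ∃ R : Finset (Sym2 V), R ⊆ Γ.edgeFinset ∧ R.card ≤ 2 ∧ Γ.edgeFinset.card ≡ R.card [MOD 3] ∧
      HasP4Decomposition (Γ.deleteEdges (R : Set (Sym2 V))) := by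
  obtain ⟨a, b, hab, ha, hb⟩ := hdeg
  replace ha : ∀ v, v ≠ a → Γ.Adj a v := fun v => adj_of_degree_eq_card_sub_one ha
  replace hb : ∀ v, v ≠ b → Γ.Adj b v := fun v => adj_of_degree_eq_card_sub_one hb
  have hcard : ({a, b} : Finset V)ᶜ.card ≠ 1 := by
    intro h
    refine hK3 ?_
    have hV : Fintype.card V = 3 := by
      rw [Finset.card_compl, Finset.card_pair hab] at h
      omega
    obtain ⟨c, hc⟩ := Finset.card_eq_one.1 h
    have hc' : ∀ v, v ≠ a → v ≠ b → v = c := fun v hva hvb => by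
      rw [← Finset.mem_singleton, ← hc]
      simp [hva, hvb]
    have htop : Γ = ⊤ := by
      ext u v
      refine ⟨fun h => h.ne, fun h => ?_⟩
      have := h.ne
      by_cases hua : u = a
      · exact hua ▸ ha v (by grind)
      by_cases hub : u = b
      · exact hub ▸ hb v (by grind)
      by_cases hva : v = a
      · exact hva ▸ (ha u hua).symm
      by_cases hvb : v = b
      · exact hvb ▸ (hb u hub).symm
      · exact absurd ((hc' u hua hub).trans (hc' v hva hvb).symm) this
    subst htop
    exact ⟨Iso.completeGraph (Fintype.equivFinOfCardEq hV)⟩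
  obtain ⟨N, R, hN, hR, hNR⟩ := nearP4Decomposable_join (a := a) (b := b) ({a, b} : Finset V)ᶜ
    (Γ.edgeFinset.filter fun e => a ∉ e ∧ b ∉ e) []
    (fun e he => Γ.not_isDiag_of_mem_edgeFinset (Finset.mem_filter.1 he).1)
    (fun e he v hv => by
      have := (Finset.mem_filter.1 he).2
      simp only [Finset.mem_compl, Finset.mem_insert, Finset.mem_singleton, not_or]
      exact ⟨fun h => this.1 (h ▸ hv), fun h => this.2 (h ▸ hv)⟩)
    (by simpa using hab) (by simp) (fun h => hcard h.1)
  rw [joinedMatching_nil, add_zero, ← edgeFinset_val_eq_join Γ hab ha hb] at hNR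
  have hnd : (N + R).Nodup := hNR ▸ Γ.edgeFinset.nodup
  obtain ⟨hNnd, hRnd, hdisj⟩ := nodup_add.1 hnd
  have hmem : ∀ e, e ∈ Γ.edgeSet ↔ e ∈ N ∨ e ∈ R := fun e => by
    rw [← mem_edgeFinset, Finset.mem_def, hNR, mem_add]
  refine ⟨⟨R, hRnd⟩, fun e he => ?_, hR, ?_, hN.hasP4Decomposition _ hNnd fun e => ?_⟩
  · exact mem_edgeFinset.2 ((hmem e).2 (.inr he))
  · rw [← Finset.card_val, hNR, card_add, Finset.card_mk]
    simpa using (Nat.modEq_zero_iff_dvd.2 hN.three_dvd_card).add_right R.card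
  · have : e ∈ ((⟨R, hRnd⟩ : Finset (Sym2 V)) : Set (Sym2 V)) ↔ e ∈ R := Iff.rfl
    rw [edgeSet_deleteEdges, Set.mem_sdiff, hmem, this]
    have := fun h : e ∈ N => Multiset.disjoint_left.1 hdisj h
    tauto

end Graphs

theorem theorem2p2 {V : Type*} [Fintype V] [DecidableEq V] (Γ : SimpleGraph V)
    [DecidableRel Γ.Adj]
    (hdeg : ∃ a b : V, a ≠ b ∧ Γ.degree a = Fintype.card V - 1 ∧
      Γ.degree b = Fintype.card V - 1)
    (hK3 : ¬ Nonempty (Γ ≃g (⊤ : SimpleGraph (Fin 3)))) :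
    (HasP4Decomposition Γ ↔ Γ.edgeFinset.card ≡ 0 [MOD 3]) ∧
    (Γ.edgeFinset.card ≡ 1 [MOD 3] →
      ∃ R : Finset (Sym2 V), R ⊆ Γ.edgeFinset ∧ R.card = 1 ∧
        HasP4Decomposition (Γ.deleteEdges (R : Set (Sym2 V)))) ∧
    (Γ.edgeFinset.card ≡ 2 [MOD 3] →
      ∃ R : Finset (Sym2 V), R ⊆ Γ.edgeFinset ∧ R.card = 2 ∧
        HasP4Decomposition (Γ.deleteEdges (R : Set (Sym2 V)))) := by
  obtain ⟨R, hR, hR2, hmod, hdec⟩ := exists_edges_hasP4Decomposition Γ hdeg hK3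
  have hcard : ∀ r < 3, Γ.edgeFinset.card ≡ r [MOD 3] → R.card = r := fun r hr h =>
    (hmod.symm.trans h).eq_of_lt_of_lt (by omega) hr
  refine ⟨⟨fun h => Nat.modEq_zero_iff_dvd.2 h.three_dvd_card_edgeFinset, fun h => ?_⟩,
    fun h => ⟨R, hR, hcard 1 (by simp) h, hdec⟩, fun h => ⟨R, hR, hcard 2 (by simp) h, hdec⟩⟩
  obtain rfl := Finset.card_eq_zero.1 (hcard 0 (by simp) h)
  simpa using hdec
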